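/- Let $n$ be a positive integer, let $S_n$ be the group of permutations of $\{1,\dots,n\}$, and let $f:S_n\to\mathbb{R}$ be a function of one of the following two forms: either $$f(\sigma)=\langle B,\sigma(A)\rangle=\sum_{i,j=1}^n b_{\sigma(i)\sigma(j)}\,a_{ij}$$ for some real $n\times n$ matrices $A=(a_{ij})$ and $B=(b_{ij})$, where $\sigma(A)$ is the matrix whose $(\sigma(i),\sigma(j))$ entry is $a_{ij}$ and $\langle X,Y\rangle=\sum_{i,j}x_{ij}y_{ij}$; or, more generally, $$f(\sigma)=\sum_{i,j=1}^n c^{ij}_{\sigma(i)\sigma(j)}$$ for some array $(c^{ij}_{kl})_{1\le i,j,k,l\le n}$ of real numbers. Let $\overline f=\frac1{n!}\sum_{\sigma\in S_n}f(\sigma)$, let $f_0=f-\overline f$, and let $\tau\in S_n$ satisfy $f_0(\tau)=\max_{\sigma\in S_n}f_0(\sigma)$. Let $k$ be an integer with $3\le k\le n-5$, let $0<\gamma<1$ be a real number, and put $$\beta(n,k)=\frac{k-2}{n^2-nk+k-2}.$$ Then a uniformly random permutation $\sigma\in S_n$ satisfies $$f_0(\sigma)\ge\gamma\,\beta(n,k)\,f_0(\tau)$$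 with probability at least $$\frac{(1-\gamma)\,\beta(n,k)}{5\,k!}.$$ -/

import Mathlib

noncomputable section

namespace QAP

/-- The action of `S_n` on real `n × n` matrices by simultaneous permutation of rows and columns:
`(permMat σ A) (σ i) (σ j) = A i j`. -/
def permMat {n : ℕ} (σ : Equiv.Perm (Fin n)) (A : Matrix (Fin n) (Fin n) ℝ) :
    Matrix (Fin n) (Fin n) ℝ :=
  Matrix.of fun i j => A (σ⁻¹ i) (σ⁻¹ j)

/-- The standard scalar product `⟨A, B⟩ = ∑ i j, a_ij b_ij` on matrices. -/
def matInner {n : ℕ} (A B : Matrix (Fin n) (Fin n) ℝ) : ℝ :=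
  ∑ i, ∑ j, A i j * B i j

/-- The objective function `f(σ) = ⟨B, σ(A)⟩` of the Quadratic Assignment Problem. -/
def objective {n : ℕ} (A B : Matrix (Fin n) (Fin n) ℝ) (σ : Equiv.Perm (Fin n)) : ℝ :=
  matInner B (permMat σ A)

/-- The objective function `f(σ) = ∑ i j, c^{ij}_{σ(i) σ(j)}` of the generalized problem;
`C i j k l` stands for `c^{ij}_{kl}`. -/
def genObjective {n : ℕ} (C : Fin n → Fin n → Fin n → Fin n → ℝ)
    (σ : Equiv.Perm (Fin n)) : ℝ :=
  ∑ i, ∑ j, C i j (σ i) (σ j)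

/-- The average value of `f` on `S_n`. -/
def average {n : ℕ} (f : Equiv.Perm (Fin n) → ℝ) : ℝ :=
  1 / (n.factorial : ℝ) * ∑ σ, f σ

/-- The shifted function `f₀ = f - average f`. -/
def shifted {n : ℕ} (f : Equiv.Perm (Fin n) → ℝ) (σ : Equiv.Perm (Fin n)) : ℝ :=
  f σ - average f

/-- The probability that a uniformly random permutation in `S_n` lies in `S`. -/
def prob {n : ℕ} (S : Set (Equiv.Perm (Fin n))) : ℝ :=
  ((PMF.uniformOfFintype (Equiv.Perm (Fin n))).toOuterMeasure S).toReal

/-- `β(n, k) = (k - 2) / (n² - n k + k - 2)`. -/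
def beta (n k : ℕ) : ℝ :=
  ((k : ℝ) - 2) / ((n : ℝ) ^ 2 - (n : ℝ) * (k : ℝ) + (k : ℝ) - 2)

end QAP

end

/-!
Let `p σ` and `q σ` be the numbers of fixed points of `σ` and of `σ ^ 2`. A linear functional on
the functions `Perm α → ℝ` that is invariant under conjugation and vanishes on `1`, `p`, `p ^ 2`
and `q` vanishes on all products of two entries of the permutation matrix, hence on every objective
function. Consequently, for suitable nonnegative weights, a weighted average of the averages of
`f₀` over the classes `(p, q) = (k, k)`, `(0, 0)` and `(0, 2)` equals `β(n, k) f₀(1)`, so one of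
these three averages is at least `β(n, k) f₀(1)`. At least a fifth of the permutations of three or
more points have no cycle of length one or two, so each class has at least `n! / (5 k!)` elements,
and Markov's inequality applies on it. Left translation replaces the identity by `τ`.
-/

namespace QAP

open Finset Equiv
open scoped BigOperators Nat

section NoShortCycles

/-- The permutations whose square is a derangement, that is, all of whose cycles have length at
least three. -/
def sqDerangements (α : Type*) [Fintype α] [DecidableEq α] : Finset (Perm α) :=
  {σ | ∀ x, σ (σ x) ≠ x}

/-- The number of permutations of `m` points all of whose cycles have length at least three. -/
def numSqDerangements (m : ℕ) : ℕ := #(sqDerangements (Fin m))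

variable {α β : Type*} [Fintype α] [DecidableEq α] [Fintype β] [DecidableEq β]

theorem mem_sqDerangements {σ : Perm α} : σ ∈ sqDerangements α ↔ ∀ x, σ (σ x) ≠ x := by
  simp only [sqDerangements, mem_filter_univ]

theorem apply_ne_of_mem_sqDerangements {σ : Perm α} (hσ : σ ∈ sqDerangements α) (x : α) :
    σ x ≠ x := fun h => mem_sqDerangements.1 hσ x (by rw [h, h])

theorem card_sqDerangements_congr (e : α ≃ β) : #(sqDerangements α) = #(sqDerangements β) := by
  refine card_equiv e.permCongr fun σ => ?_
  simp only [mem_sqDerangements, permCongr_apply, symm_apply_apply, ne_eq,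
    ← e.eq_symm_apply]
  exact ⟨fun h x => h _, fun h x => by simpa using h (e x)⟩

theorem card_sqDerangements (α : Type*) [Fintype α] [DecidableEq α] :
    #(sqDerangements α) = numSqDerangements (Fintype.card α) :=
  card_sqDerangements_congr (Fintype.equivFin α)

theorem numSqDerangements_le_card_extensions (S : Finset α) {ρ : Perm α} (hρ : ρ.support ⊆ S) :
    numSqDerangements (Fintype.card α - #S) ≤
      #{π : Perm α | (∀ x ∈ S, π x = ρ x) ∧ ∀ x ∉ S, π (π x) ≠ x} := by
  have hcard : Fintype.card {x // x ∉ S} = Fintype.card α - #S := by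
    rw [Fintype.card_subtype_compl, Fintype.card_coe]
  rw [← hcard, ← card_sqDerangements]
  refine card_le_card_of_injOn (fun σ => ρ * Perm.ofSubtype σ) (fun σ hσ => ?_)
    fun σ _ σ' _ h => Perm.ofSubtype_injective (mul_left_cancel h)
  have hout (x : {x // x ∉ S}) : (ρ * Perm.ofSubtype σ) x = σ x := by
    rw [Perm.mul_apply, Perm.ofSubtype_apply_coe]
    exact Perm.notMem_support.1 fun h => (σ x).2 (hρ h)
  refine mem_coe.2 <| (mem_filter_univ _).2
    ⟨fun x hx => ?_, fun x hx h => mem_sqDerangements.1 hσ ⟨x, hx⟩ (Subtype.ext ?_)⟩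
  · rw [Perm.mul_apply, Perm.ofSubtype_apply_of_not_mem σ (not_not.2 hx)]
  · rwa [hout ⟨x, hx⟩, hout] at h

theorem numSqDerangements_le_card_threeCycle {a b c : α} (hab : a ≠ b) (hac : a ≠ c)
    (hbc : b ≠ c) :
    numSqDerangements (Fintype.card α - 3) ≤
      #{π ∈ sqDerangements α | π a = b ∧ π b = c ∧ π c = a} := by
  have hsupp : (swap a b * swap b c).support ⊆ {a, b, c} :=
    (Perm.support_swap_mul_swap (by simp [hab, hac, hbc])).subset
  rw [← card_eq_three.2 ⟨a, b, c, hab, hac, hbc, rfl⟩]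
  refine (numSqDerangements_le_card_extensions _ hsupp).trans (card_le_card fun π hπ => ?_)
  obtain ⟨hin, hout⟩ := (mem_filter_univ _).1 hπ
  have ha : π a = b := by
    rw [hin a (by simp), Perm.mul_apply, swap_apply_of_ne_of_ne hab hac, swap_apply_left]
  have hb : π b = c := by
    rw [hin b (by simp), Perm.mul_apply, swap_apply_left, swap_apply_of_ne_of_ne hac.symm hbc.symm]
  have hc : π c = a := by
    rw [hin c (by simp), Perm.mul_apply, swap_apply_right, swap_apply_right]
  refine mem_filter.2 ⟨mem_sqDerangements.2 fun x => ?_, ha, hb, hc⟩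
  by_cases hx : x ∈ ({a, b, c} : Finset α)
  · simp only [mem_insert, mem_singleton] at hx
    rcases hx with rfl | rfl | rfl
    · rw [ha, hb]; exact hac.symm
    · rw [hb, hc]; exact hab
    · rw [hc, ha]; exact hbc
  · exact hout x hx

theorem mul_numSqDerangements_le_card_threeCycle (a : α) :
    (Fintype.card α - 1) * (Fintype.card α - 2) * numSqDerangements (Fintype.card α - 3) ≤
      #{π ∈ sqDerangements α | π (π (π a)) = a} := by
  have hpairs : #(univ.erase a).offDiag = (Fintype.card α - 1) * (Fintype.card α - 2) := by
    rw [offDiag_card, card_erase_of_mem (mem_univ a), card_univ, ← Nat.mul_sub_one, Nat.sub_sub]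
  rw [← hpairs, ← mul_one #{π ∈ sqDerangements α | _}]
  refine card_mul_le_card_mul (fun p π => π a = p.1 ∧ π p.1 = p.2) (fun p hp => ?_) fun π _ => ?_
  · obtain ⟨h₁, h₂, h₁₂⟩ := mem_offDiag.1 hp
    refine (numSqDerangements_le_card_threeCycle (ne_of_mem_erase h₁).symm
      (ne_of_mem_erase h₂).symm h₁₂).trans (card_le_card fun π hπ => ?_)
    obtain ⟨hπ, ha, hb, hc⟩ := mem_filter.1 hπ
    exact mem_filter.2 ⟨mem_filter.2 ⟨hπ, by rw [ha, hb, hc]⟩, ha, hb⟩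
  · refine card_le_one.2 fun p hp p' hp' => ?_
    obtain ⟨-, hp₁, hp₂⟩ := mem_filter.1 hp
    obtain ⟨-, hp₁', hp₂'⟩ := mem_filter.1 hp'
    have h₁ : p.1 = p'.1 := hp₁.symm.trans hp₁'
    exact Prod.ext h₁ (by rw [← hp₂, ← hp₂', h₁])

/-- The permutation `σ` with the new point `none` inserted on a cycle of `σ` just before `a`, so
that `σ⁻¹ a ↦ none ↦ a`. -/
def insertBefore {β : Type*} [DecidableEq β] (a : β) (σ : Perm β) : Perm (Option β) :=
  Perm.decomposeOption.symm (some a, σ)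

theorem insertBefore_none {β : Type*} [DecidableEq β] (a : β) (σ : Perm β) :
    insertBefore a σ none = some a := by
  simp [insertBefore]

theorem insertBefore_some {β : Type*} [DecidableEq β] (a : β) (σ : Perm β) (x : β) :
    insertBefore a σ (some x) = if σ x = a then none else some (σ x) := by
  simp [insertBefore, swap_apply_def]

theorem insertBefore_mem_sqDerangements (a : β) {σ : Perm β} (hσ : σ ∈ sqDerangements β) :
    insertBefore a σ ∈ sqDerangements (Option β) := by
  have hfix := apply_ne_of_mem_sqDerangements hσ
  have hsq := mem_sqDerangements.1 hσ
  rw [mem_sqDerangements]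
  rintro (_ | x)
  · simp [insertBefore_none, insertBefore_some, hfix a]
  · by_cases hx : σ x = a
    · have hax : a ≠ x := hx ▸ hfix x
      simp [insertBefore_some, insertBefore_none, hx, hax]
    · by_cases hx₂ : σ (σ x) = a
      · simp [insertBefore_some, hx, hx₂]
      · simp [insertBefore_some, hx, hx₂, hsq x]

theorem insertBefore_cube_none_ne (a : β) {σ : Perm β} (hσ : σ ∈ sqDerangements β) :
    insertBefore a σ (insertBefore a σ (insertBefore a σ none)) ≠ none := by
  simp [insertBefore_none, insertBefore_some, apply_ne_of_mem_sqDerangements hσ a,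
    mem_sqDerangements.1 hσ a]

theorem mul_card_sqDerangements_le_card_cube_ne :
    Fintype.card β * #(sqDerangements β) ≤
      #{π ∈ sqDerangements (Option β) | π (π (π none)) ≠ none} := by
  rw [← card_univ, ← card_product]
  refine card_le_card_of_injOn (fun p => insertBefore p.1 p.2) (fun p hp => ?_) fun p _ q _ h => ?_
  · have hp₂ := (mem_product.1 hp).2
    exact mem_filter.2
      ⟨insertBefore_mem_sqDerangements p.1 hp₂, insertBefore_cube_none_ne p.1 hp₂⟩
  · have h' := Perm.decomposeOption.symm.injective h
    simp only [Prod.mk.injEq, Option.some.injEq] at h'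
    exact Prod.ext h'.1 h'.2

-- The new point lies either on a three-cycle or on a longer cycle, from which it can be removed.
theorem numSqDerangements_recurrence (m : ℕ) :
    (m + 2) * numSqDerangements (m + 2) + (m + 2) * (m + 1) * numSqDerangements m ≤
      numSqDerangements (m + 3) := by
  have hlong := mul_card_sqDerangements_le_card_cube_ne (β := Fin (m + 2))
  have hthree := mul_numSqDerangements_le_card_threeCycle (none : Option (Fin (m + 2)))
  have hsplit := card_filter_add_card_filter_not (s := sqDerangements (Option (Fin (m + 2))))
    fun π => π (π (π none)) = none
  simp only [card_sqDerangements, Fintype.card_option, Fintype.card_fin] at hlong hthree hsplit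
  rw [← hsplit, add_comm]
  exact add_le_add hthree hlong

theorem factorial_le_numSqDerangements {m : ℕ} (hm : 3 ≤ m) : m ! ≤ 5 * numSqDerangements m := by
  have h₀ : numSqDerangements 0 = 1 := rfl
  have h₃ : 2 ≤ numSqDerangements 3 := by
    linarith [numSqDerangements_recurrence 0]
  have h₄ : 6 ≤ numSqDerangements 4 := by
    linarith [numSqDerangements_recurrence 1]
  have h₅ : 24 ≤ numSqDerangements 5 := by
    linarith [numSqDerangements_recurrence 2]
  induction m using Nat.strong_induction_on with
  | _ m ih =>
    obtain rfl | rfl | rfl | ⟨l, rfl⟩ : m = 3 ∨ m = 4 ∨ m = 5 ∨ ∃ l, m = l + 6 := by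
      rw [← le_iff_exists_add']
      omega
    · simp only [Nat.factorial]; omega
    · simp only [Nat.factorial]; omega
    · simp only [Nat.factorial]; omega
    · calc (l + 6)! = (l + 5) * (l + 5)! + (l + 5) * (l + 4) * (l + 3)! := by
            simp only [Nat.factorial_succ]; ring
        _ ≤ (l + 5) * (5 * numSqDerangements (l + 5)) +
            (l + 5) * (l + 4) * (5 * numSqDerangements (l + 3)) := by
          gcongr
          · exact ih (l + 5) (by omega) (by omega)
          · exact ih (l + 3) (by omega) (by omega)
        _ = 5 * ((l + 5) * numSqDerangements (l + 5) +
            (l + 5) * (l + 4) * numSqDerangements (l + 3)) := by ring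
        _ ≤ 5 * numSqDerangements (l + 6) :=
          Nat.mul_le_mul_left 5 (numSqDerangements_recurrence (l + 3))

end NoShortCycles

section FixCount

variable {α : Type*} [Fintype α] [DecidableEq α]

/-- The number of fixed points of a permutation. -/
def fixCount (σ : Perm α) : ℕ := #{x | σ x = x}

/-- The permutations with exactly `a` fixed points whose square has exactly `b` fixed points, so
that `b` points lie on cycles of length at most two. -/
def fixCountClass (α : Type*) [Fintype α] [DecidableEq α] (a b : ℕ) : Finset (Perm α) :=
  {σ | fixCount σ = a ∧ fixCount (σ ^ 2) = b}

theorem mem_fixCountClass {a b : ℕ} {σ : Perm α} :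
    σ ∈ fixCountClass α a b ↔ fixCount σ = a ∧ fixCount (σ ^ 2) = b :=
  mem_filter_univ σ

theorem fixCount_one : fixCount (1 : Perm α) = Fintype.card α := by
  simp [fixCount]

theorem fixCount_conj (π σ : Perm α) : fixCount (π * σ * π⁻¹) = fixCount σ := by
  refine (card_equiv π fun x => ?_).symm
  rw [mem_filter_univ, mem_filter_univ]
  simp

theorem conj_mem_fixCountClass {a b : ℕ} (π : Perm α) {σ : Perm α}
    (hσ : σ ∈ fixCountClass α a b) : π * σ * π⁻¹ ∈ fixCountClass α a b := by
  rwa [mem_fixCountClass, conj_pow, fixCount_conj, fixCount_conj, ← mem_fixCountClass]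

theorem choose_mul_numSqDerangements_le_card_fixCountClass {a b : ℕ}
    (hρ : ∀ S : Finset α, #S = b →
      ∃ ρ : Perm α, ρ.support ⊆ S ∧ ρ ^ 2 = 1 ∧ #(S \ ρ.support) = a) :
    (Fintype.card α).choose b * numSqDerangements (Fintype.card α - b) ≤
      #(fixCountClass α a b) := by
  rw [← card_univ, ← card_powersetCard, ← mul_one #(fixCountClass α a b)]
  refine card_mul_le_card_mul (fun S π => ({x | (π ^ 2) x = x} : Finset α) = S)
    (fun S hS => ?_) fun π _ => card_le_one.2 fun S hS T hT => ?_
  · replace hS := (mem_powersetCard.1 hS).2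
    obtain ⟨ρ, hsupp, hsq, rfl⟩ := hρ S hS
    rw [card_univ, ← hS]
    refine (numSqDerangements_le_card_extensions S hsupp).trans (card_le_card fun π hπ => ?_)
    obtain ⟨hin, hout⟩ := (mem_filter_univ _).1 hπ
    have hinv : ∀ x ∈ S, (π ^ 2) x = x := fun x hx => by
      have hρx : ρ x ∈ S := by
        by_cases hx' : x ∈ ρ.support
        · exact hsupp (Perm.apply_mem_support.2 hx')
        · rwa [Perm.notMem_support.1 hx']
      rw [sq, Perm.mul_apply, hin x hx, hin _ hρx, ← Perm.mul_apply, ← sq, hsq, Perm.one_apply]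
    have hsqfix : ({x | (π ^ 2) x = x} : Finset α) = S := by
      ext x
      refine (mem_filter_univ x).trans ⟨fun h => ?_, hinv x⟩
      by_contra hx
      exact hout x hx h
    have hfix : ({x | π x = x} : Finset α) = S \ ρ.support := by
      ext x
      rw [mem_filter_univ, mem_sdiff, Perm.notMem_support]
      refine ⟨fun h => ?_, fun ⟨hx, h⟩ => (hin x hx).trans h⟩
      have hx : x ∈ S := by
        by_contra hx
        exact hout x hx (by rw [h, h])
      exact ⟨hx, (hin x hx).symm.trans h⟩
    refine mem_filter.2 ⟨mem_fixCountClass.2 ⟨?_, ?_⟩, hsqfix⟩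
    · rw [fixCount, hfix]
    · rw [fixCount, hsqfix]
  · exact (mem_filter.1 hS).2.symm.trans (mem_filter.1 hT).2

theorem factorial_le_mul_choose_mul_numSqDerangements {n b : ℕ} (h : b + 3 ≤ n) :
    n ! ≤ 5 * b ! * (n.choose b * numSqDerangements (n - b)) := by
  calc n ! = n.choose b * b ! * (n - b)! :=
        (Nat.choose_mul_factorial_mul_factorial (by omega)).symm
    _ ≤ n.choose b * b ! * (5 * numSqDerangements (n - b)) :=
        Nat.mul_le_mul_left _ (factorial_le_numSqDerangements (by omega))
    _ = 5 * b ! * (n.choose b * numSqDerangements (n - b)) := by ring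

theorem factorial_le_mul_card_fixCountClass_self {k : ℕ} (h : k + 3 ≤ Fintype.card α) :
    (Fintype.card α)! ≤ 5 * k ! * #(fixCountClass α k k) :=
  (factorial_le_mul_choose_mul_numSqDerangements h).trans <| Nat.mul_le_mul_left _ <|
    choose_mul_numSqDerangements_le_card_fixCountClass fun S hS => ⟨1, by simp [hS]⟩

theorem factorial_le_mul_card_fixCountClass_zero_two (h : 5 ≤ Fintype.card α) :
    (Fintype.card α)! ≤ 5 * 2! * #(fixCountClass α 0 2) := by
  refine (factorial_le_mul_choose_mul_numSqDerangements h).trans <| Nat.mul_le_mul_left _ <|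
    choose_mul_numSqDerangements_le_card_fixCountClass fun S hS => ?_
  obtain ⟨x, y, hxy, rfl⟩ := card_eq_two.1 hS
  exact ⟨swap x y, by simp [Perm.support_swap hxy, sq]⟩

end FixCount

section Average

/-- The average over the finite set `X` as a linear functional on real functions; it is zero if
`X` is empty. -/
noncomputable def avgOn {ι : Type*} (X : Finset ι) : (ι → ℝ) →ₗ[ℝ] ℝ where
  toFun f := 𝔼 x ∈ X, f x
  map_add' := expect_add_distrib X
  map_smul' c f := (smul_expect c X f).symm

variable {ι : Type*} {X : Finset ι}

theorem avgOn_apply (f : ι → ℝ) : avgOn X f = 𝔼 x ∈ X, f x := rfl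

theorem card_mul_avgOn (f : ι → ℝ) : #X * avgOn X f = ∑ x ∈ X, f x :=
  card_mul_expect X f

theorem avgOn_eq_of_forall {f : ι → ℝ} {c : ℝ} (hX : X.Nonempty) (h : ∀ x ∈ X, f x = c) :
    avgOn X f = c :=
  (expect_congr rfl h).trans (expect_const hX c)

end Average

section Entries

variable {α : Type*} [DecidableEq α]

/-- The `(a, c)` entry of the permutation matrix of `σ`, as a function of `σ`. -/
def entry (a c : α) : Perm α → ℝ := fun σ => if σ a = c then 1 else 0

theorem entry_mul_entry_self (a c d : α) :
    entry a c * entry a d = if c = d then entry a c else 0 := by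
  ext σ
  by_cases hc : σ a = c <;> by_cases hcd : c = d <;> simp_all [entry]

theorem entry_mul_entry_of_ne {a b : α} (hab : a ≠ b) (c : α) : entry a c * entry b c = 0 := by
  ext σ
  by_cases ha : σ a = c
  · simp [entry, ← ha, hab.symm]
  · simp [entry, ha]

variable [Fintype α]

theorem sum_entry (a : α) : ∑ c, entry a c = 1 := by
  ext σ
  simp [entry]

theorem sum_entry_self : ∑ a : α, entry a a = fun σ => (fixCount σ : ℝ) := by
  ext σ
  simp [entry, fixCount]

theorem sum_entry_mul_entry_self :
    ∑ a : α, ∑ b, entry a a * entry b b = fun σ => (fixCount σ : ℝ) ^ 2 := by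
  rw [← sum_mul_sum, sum_entry_self]
  ext σ
  exact (sq _).symm

theorem sum_entry_mul_entry_swap :
    ∑ a : α, ∑ b, entry a b * entry b a = fun σ => (fixCount (σ ^ 2) : ℝ) := by
  ext σ
  simp only [Finset.sum_apply, Pi.mul_apply, entry, ite_mul, one_mul, zero_mul, sum_ite_eq,
    mem_univ, if_true]
  simp [fixCount, sq]

theorem card_perm_fixing (S : Finset α) :
    #{σ : Perm α | ∀ x ∈ S, σ x = x} = (Fintype.card α - #S)! := by
  rw [← Fintype.card_coe S, ← Fintype.card_subtype_compl, ← Fintype.card_perm,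
    Fintype.card_congr (Perm.subtypeEquivSubtypePerm (· ∉ S)), Fintype.card_subtype]
  simp only [not_not]

theorem avgOn_univ_entry_mul_entry_self (a b : α) :
    avgOn univ (entry a a * entry b b) =
      ((Fintype.card α - #{a, b})! : ℝ) / (Fintype.card α)! := by
  rw [avgOn_apply, Fintype.expect_eq_sum_div_card, Fintype.card_perm, ← card_perm_fixing,
    card_filter]
  simp [entry, ← ite_and, and_comm]

theorem avgOn_univ_entry_mul_entry_swap (a b : α) :
    avgOn univ (entry a b * entry b a) = avgOn univ (entry a a * entry b b) :=
  Fintype.expect_equiv (Equiv.mulLeft (swap a b)) _ _ fun σ => by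
    simp [entry, swap_apply_eq_iff]

theorem avgOn_univ_entry_self [Nonempty α] (a : α) :
    avgOn univ (entry a a) = 1 / Fintype.card α := by
  have h := avgOn_univ_entry_mul_entry_self a a
  rw [entry_mul_entry_self, if_pos rfl, pair_eq_singleton, card_singleton] at h
  rw [h, ← Nat.mul_factorial_pred (Fintype.card_ne_zero (α := α))]
  push_cast
  field_simp

theorem avgOn_univ_fixCount [Nonempty α] :
    avgOn univ (fun σ : Perm α => (fixCount σ : ℝ)) = 1 := by
  rw [← sum_entry_self, map_sum]
  simp [avgOn_univ_entry_self]

theorem avgOn_univ_fixCount_sq [Nontrivial α] :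
    avgOn univ (fun σ : Perm α => (fixCount σ : ℝ) ^ 2) = 2 := by
  obtain ⟨m, hm⟩ : ∃ m, Fintype.card α = m + 2 :=
    Nat.exists_eq_add_of_le' (Fintype.one_lt_card (α := α))
  have hne {a b : α} (hab : a ≠ b) :
      avgOn univ (entry a a * entry b b) = 1 / ((m + 2) * (m + 1)) := by
    rw [avgOn_univ_entry_mul_entry_self, card_pair hab, hm, Nat.factorial_succ,
      Nat.factorial_succ, Nat.add_sub_cancel]
    push_cast
    field_simp
    ring
  have hrow (a : α) : ∑ b, avgOn univ (entry a a * entry b b) = 2 / (m + 2) := by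
    rw [← add_sum_erase _ _ (mem_univ a),
      sum_congr rfl fun b hb => hne (ne_of_mem_erase hb).symm, sum_const,
      card_erase_of_mem (mem_univ a), card_univ, entry_mul_entry_self, if_pos rfl,
      avgOn_univ_entry_self, hm, nsmul_eq_mul]
    push_cast [Nat.add_sub_cancel]
    field_simp
    ring
  simp_rw [← sum_entry_mul_entry_self, map_sum, hrow, sum_const, card_univ, hm, nsmul_eq_mul]
  push_cast
  field_simp

theorem avgOn_univ_fixCount_pow_two :
    avgOn univ (fun σ : Perm α => (fixCount (σ ^ 2) : ℝ)) =
      avgOn univ (fun σ : Perm α => (fixCount σ : ℝ) ^ 2) := by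
  simp_rw [← sum_entry_mul_entry_swap, ← sum_entry_mul_entry_self, map_sum,
    avgOn_univ_entry_mul_entry_swap]

end Entries

section ClassFunctionals

theorem eq_zero_of_sum_eq_zero {α : Type*} [Fintype α] {g : α → ℝ} (T : Finset α)
    (hT : ∀ d ∈ T, g d = 0) (hconst : ∀ d ∉ T, ∀ d' ∉ T, g d = g d') (hsum : ∑ d, g d = 0) :
    g = 0 := by
  classical
  funext d
  by_cases hd : d ∈ T
  · exact hT d hd
  have hcompl : ∑ d' ∈ Tᶜ, g d' = #Tᶜ * g d := by
    rw [← nsmul_eq_mul, ← sum_const]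
    exact sum_congr rfl fun d' hd' => hconst _ (mem_compl.1 hd') _ hd
  rw [← sum_add_sum_compl T, sum_eq_zero hT, zero_add, hcompl, mul_eq_zero,
    Nat.cast_eq_zero, card_eq_zero] at hsum
  exact hsum.resolve_left (ne_empty_of_mem (mem_compl.2 hd))

theorem eq_zero_of_perm_invariant {α : Type*} [Fintype α] {F : α → α → ℝ}
    (hF : ∀ (π : Perm α) a b, F (π a) (π b) = F a b) (hdiag : ∀ a, F a a = 0)
    (hsum : ∑ a, ∑ b, F a b = 0) : F = 0 := by
  classical
  have hrow (a : α) : ∑ b, F a b = 0 := by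
    refine congrFun (eq_zero_of_sum_eq_zero ∅ (by simp) (fun a _ a' _ => ?_) hsum) a
    rw [← Equiv.sum_comp (swap a a')]
    exact sum_congr rfl fun b _ => by rw [← hF (swap a a'), swap_apply_left, swap_apply_self]
  funext a
  refine eq_zero_of_sum_eq_zero {a} (by simp [hdiag]) (fun b hb b' hb' => ?_) (hrow a)
  rw [mem_singleton] at hb hb'
  rw [← hF (swap b b'), swap_apply_left, swap_apply_of_ne_of_ne (Ne.symm hb) (Ne.symm hb')]

variable {α : Type*} [Fintype α] [DecidableEq α]

/-- A linear functional on the functions `Perm α → ℝ` that is invariant under conjugation and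
vanishes on `1`, `p`, `p ^ 2` and `q`, where `p σ` and `q σ` are the numbers of fixed points of
`σ` and of `σ ^ 2`. -/
structure KillsFixCounts (L : (Perm α → ℝ) →ₗ[ℝ] ℝ) : Prop where
  map_conj (π : Perm α) (g : Perm α → ℝ) : L (fun σ => g (π * σ * π⁻¹)) = L g
  map_one : L 1 = 0
  map_fixCount : L (fun σ => (fixCount σ : ℝ)) = 0
  map_fixCount_sq : L (fun σ => (fixCount σ : ℝ) ^ 2) = 0
  map_fixCount_pow_two : L (fun σ => (fixCount (σ ^ 2) : ℝ)) = 0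

namespace KillsFixCounts

variable {L : (Perm α → ℝ) →ₗ[ℝ] ℝ}

theorem map_entry_mul_entry_apply (hL : KillsFixCounts L) (π : Perm α) (a b c d : α) :
    L (entry (π a) (π c) * entry (π b) (π d)) = L (entry a c * entry b d) := by
  rw [← hL.map_conj π]
  congr 1
  ext σ
  simp [entry]

theorem map_entry_apply (hL : KillsFixCounts L) (π : Perm α) (a c : α) :
    L (entry (π a) (π c)) = L (entry a c) := by
  simpa [entry_mul_entry_self] using hL.map_entry_mul_entry_apply π a a c c

theorem map_entry (hL : KillsFixCounts L) (a c : α) : L (entry a c) = 0 := by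
  have hself (a : α) : L (entry a a) = 0 := by
    refine congrFun (eq_zero_of_sum_eq_zero (g := fun a => L (entry a a)) ∅ (by simp)
      (fun a _ a' _ => ?_) ?_) a
    · rw [← hL.map_entry_apply (swap a a'), swap_apply_left]
    · rw [← map_sum, sum_entry_self, hL.map_fixCount]
  have hsum : ∑ a, ∑ c, L (entry a c) = 0 := by
    simp only [← map_sum L, sum_entry, hL.map_one, sum_const_zero]
  exact congrFun₂ (eq_zero_of_perm_invariant hL.map_entry_apply hself hsum) a c

theorem map_entry_mul_entry_same_row (hL : KillsFixCounts L) (a c d : α) :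
    L (entry a c * entry a d) = 0 := by
  rw [entry_mul_entry_self]
  split_ifs
  · exact hL.map_entry a c
  · exact map_zero L

theorem map_entry_mul_entry_same_col (hL : KillsFixCounts L) (a b c : α) :
    L (entry a c * entry b c) = 0 := by
  obtain rfl | hab := eq_or_ne a b
  · exact hL.map_entry_mul_entry_same_row a c c
  · rw [entry_mul_entry_of_ne hab, map_zero]

theorem map_entry_self_mul_entry_self (hL : KillsFixCounts L) (a b : α) :
    L (entry a a * entry b b) = 0 := by
  refine congrFun₂ (eq_zero_of_perm_invariant (F := fun a b => L (entry a a * entry b b))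
    (fun π a b => hL.map_entry_mul_entry_apply π a b a b)
    (fun a => hL.map_entry_mul_entry_same_row a a a) ?_) a b
  simp_rw [← map_sum, sum_entry_mul_entry_self, hL.map_fixCount_sq]

theorem map_entry_mul_entry_swap (hL : KillsFixCounts L) (a b : α) :
    L (entry a b * entry b a) = 0 := by
  refine congrFun₂ (eq_zero_of_perm_invariant (F := fun a b => L (entry a b * entry b a))
    (fun π a b => hL.map_entry_mul_entry_apply π a b b a)
    (fun a => hL.map_entry_mul_entry_same_row a a a) ?_) a b
  simp_rw [← map_sum, sum_entry_mul_entry_swap, hL.map_fixCount_pow_two]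

-- For fixed `a`, `b`, `c`, invariance leaves only one value outside `d ∈ {a, b, c}`, and the sum
-- over all `d` is `L (entry a c) = 0`.
theorem map_entry_mul_entry_of_forall_mem (hL : KillsFixCounts L) {a b c : α}
    (h : ∀ d ∈ ({a, b, c} : Finset α), L (entry a c * entry b d) = 0) (d : α) :
    L (entry a c * entry b d) = 0 := by
  refine congrFun (eq_zero_of_sum_eq_zero (g := fun d => L (entry a c * entry b d)) {a, b, c} h
    (fun d hd d' hd' => ?_) ?_) d
  · simp only [mem_insert, mem_singleton, not_or] at hd hd'
    rw [← hL.map_entry_mul_entry_apply (swap d d'), swap_apply_left,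
      swap_apply_of_ne_of_ne (Ne.symm hd.1) (Ne.symm hd'.1),
      swap_apply_of_ne_of_ne (Ne.symm hd.2.1) (Ne.symm hd'.2.1),
      swap_apply_of_ne_of_ne (Ne.symm hd.2.2) (Ne.symm hd'.2.2)]
  · rw [← map_sum, ← mul_sum, sum_entry, mul_one, hL.map_entry]

theorem map_entry_mul_entry (hL : KillsFixCounts L) (a b c d : α) :
    L (entry a c * entry b d) = 0 := by
  have hfixed (a b d : α) : L (entry a a * entry b d) = 0 := by
    refine hL.map_entry_mul_entry_of_forall_mem (fun d hd => ?_) d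
    simp only [mem_insert, mem_singleton] at hd
    rcases hd with rfl | rfl | rfl
    · exact hL.map_entry_mul_entry_same_col ..
    · exact hL.map_entry_self_mul_entry_self ..
    · exact hL.map_entry_mul_entry_same_col ..
  have hpath (a b d : α) : L (entry a b * entry b d) = 0 := by
    refine hL.map_entry_mul_entry_of_forall_mem (fun d hd => ?_) d
    simp only [mem_insert, mem_singleton] at hd
    rcases hd with rfl | rfl | rfl
    · exact hL.map_entry_mul_entry_swap ..
    · exact hL.map_entry_mul_entry_same_col ..
    · exact hL.map_entry_mul_entry_same_col ..
  refine hL.map_entry_mul_entry_of_forall_mem (fun d hd => ?_) d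
  simp only [mem_insert, mem_singleton] at hd
  rcases hd with rfl | rfl | rfl
  · rw [mul_comm, hpath]
  · rw [mul_comm, hfixed]
  · exact hL.map_entry_mul_entry_same_col ..

theorem map_genObjective {n : ℕ} {L : (Perm (Fin n) → ℝ) →ₗ[ℝ] ℝ} (hL : KillsFixCounts L)
    (C : Fin n → Fin n → Fin n → Fin n → ℝ) : L (genObjective C) = 0 := by
  have hexpand : genObjective C =
      ∑ i, ∑ j, ∑ u, ∑ v, C i j u v • (entry i u * entry j v) := by
    ext σ
    simp [genObjective, entry]
  simp_rw [hexpand, map_sum, map_smul, hL.map_entry_mul_entry, smul_zero, sum_const_zero]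

end KillsFixCounts

end ClassFunctionals

section ClassCombination

theorem avgOn_conj {α : Type*} {X : Finset (Perm α)} (hX : ∀ π, ∀ σ ∈ X, π * σ * π⁻¹ ∈ X)
    (π : Perm α) (g : Perm α → ℝ) : avgOn X (fun σ => g (π * σ * π⁻¹)) = avgOn X g := by
  refine expect_equiv (MulAut.conj π).toEquiv (fun σ => ⟨hX π σ, fun hσ => ?_⟩) fun σ _ => rfl
  simpa [mul_assoc] using hX π⁻¹ _ hσ

variable {α : Type*} [Fintype α] [DecidableEq α]

theorem avgOn_fixCountClass {a b : ℕ} (hne : (fixCountClass α a b).Nonempty) (F : ℕ → ℕ → ℝ) :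
    avgOn (fixCountClass α a b) (fun σ => F (fixCount σ) (fixCount (σ ^ 2))) = F a b := by
  refine avgOn_eq_of_forall hne fun σ hσ => ?_
  rw [(mem_fixCountClass.1 hσ).1, (mem_fixCountClass.1 hσ).2]

/-- The difference between a weighted average of the averages of `f` over the three classes
`(k, k)`, `(0, 0)`, `(0, 2)` of `fixCountClass` and the weighted average of `f 1` and the average
of `f` over all permutations, as a linear functional of `f`. Each of the two sets of weights adds
up to `1`. -/
noncomputable def classDefect (α : Type*) [Fintype α] [DecidableEq α] (β w : ℝ) (k : ℕ) :
    (Perm α → ℝ) →ₗ[ℝ] ℝ :=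
  w • avgOn (fixCountClass α k k) + ((1 + β) / 2 - w) • avgOn (fixCountClass α 0 0) +
    ((1 - β) / 2) • avgOn (fixCountClass α 0 2) - (β • avgOn {1} + (1 - β) • avgOn univ)

theorem classDefect_apply (β w : ℝ) (k : ℕ) (f : Perm α → ℝ) :
    classDefect α β w k f =
      w * avgOn (fixCountClass α k k) f + ((1 + β) / 2 - w) * avgOn (fixCountClass α 0 0) f +
        (1 - β) / 2 * avgOn (fixCountClass α 0 2) f - (β * f 1 + (1 - β) * avgOn univ f) := by
  simp [classDefect, avgOn_apply]

theorem killsFixCounts_classDefect {β w : ℝ} {k : ℕ} [Nontrivial α]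
    (hk : (fixCountClass α k k).Nonempty) (h₀ : (fixCountClass α 0 0).Nonempty)
    (h₂ : (fixCountClass α 0 2).Nonempty) (hwk : w * k = 1 + β * (Fintype.card α - 1))
    (hwk' : w * k ^ 2 = 2 + β * (Fintype.card α ^ 2 - 2)) :
    KillsFixCounts (classDefect α β w k) := by
  have heval (F : ℕ → ℕ → ℝ) :
      classDefect α β w k (fun σ => F (fixCount σ) (fixCount (σ ^ 2))) =
        w * F k k + ((1 + β) / 2 - w) * F 0 0 + (1 - β) / 2 * F 0 2 -
          (β * F (Fintype.card α) (Fintype.card α) +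
            (1 - β) * avgOn univ fun σ : Perm α => F (fixCount σ) (fixCount (σ ^ 2))) := by
    rw [classDefect_apply, avgOn_fixCountClass hk, avgOn_fixCountClass h₀,
      avgOn_fixCountClass h₂, one_pow, fixCount_one]
  constructor
  · intro π g
    simp only [classDefect_apply, avgOn_conj fun π _ => conj_mem_fixCountClass π,
      avgOn_conj (X := univ) fun _ _ _ => mem_univ _, mul_one, mul_inv_cancel]
  · refine (heval fun _ _ => 1).trans ?_
    rw [avgOn_eq_of_forall univ_nonempty fun _ _ => rfl]
    ring
  · refine (heval fun a _ => a).trans ?_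
    rw [avgOn_univ_fixCount]
    push_cast
    linear_combination hwk
  · refine (heval fun a _ => (a : ℝ) ^ 2).trans ?_
    rw [avgOn_univ_fixCount_sq]
    push_cast
    linear_combination hwk'
  · refine (heval fun _ b => b).trans ?_
    rw [avgOn_univ_fixCount_pow_two, avgOn_univ_fixCount_sq]
    push_cast
    linear_combination hwk

end ClassCombination

section Beta

variable {n k : ℕ}

theorem beta_mul_denom (hk : 2 ≤ k) (hkn : k < n) :
    beta n k * ((n : ℝ) ^ 2 - n * k + k - 2) = k - 2 := by
  have hk' : (2 : ℝ) ≤ k := by exact_mod_cast hk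
  have hkn' : (k : ℝ) < n := by exact_mod_cast hkn
  have hD : 0 < (n : ℝ) * (n - k) := mul_pos (by linarith) (by linarith)
  exact div_mul_cancel₀ _ (by linarith)

theorem beta_nonneg (hk : 2 ≤ k) (hkn : k ≤ n) : 0 ≤ beta n k := by
  have hk' : (2 : ℝ) ≤ k := by exact_mod_cast hk
  have hkn' : (k : ℝ) ≤ n := by exact_mod_cast hkn
  have hD : 0 ≤ (n : ℝ) * (n - k) := mul_nonneg (by linarith) (by linarith)
  exact div_nonneg (by linarith) (by linarith)

theorem beta_le_one (hk : 2 ≤ k) (hkn : k ≤ n) : beta n k ≤ 1 := by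
  have hk' : (2 : ℝ) ≤ k := by exact_mod_cast hk
  have hkn' : (k : ℝ) ≤ n := by exact_mod_cast hkn
  have hD : 0 ≤ (n : ℝ) * (n - k) := mul_nonneg (by linarith) (by linarith)
  exact div_le_one_of_le₀ (by linarith) (by linarith)

theorem two_mul_one_add_beta_le (hk : 2 ≤ k) (hkn : k < n) :
    2 * (1 + beta n k * (n - 1)) ≤ k * (1 + beta n k) := by
  have hk' : (2 : ℝ) ≤ k := by exact_mod_cast hk
  have hkn' : (k : ℝ) < n := by exact_mod_cast hkn
  have h : 0 ≤ beta n k * (((n : ℝ) - k) * (n - 2)) :=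
    mul_nonneg (beta_nonneg hk hkn.le) (mul_nonneg (by linarith) (by linarith))
  linarith [beta_mul_denom hk hkn]

theorem exists_weight_beta (hk : 2 ≤ k) (hkn : k < n) :
    ∃ w : ℝ, 0 < w ∧ w ≤ (1 + beta n k) / 2 ∧ w * k = 1 + beta n k * (n - 1) ∧
      w * k ^ 2 = 2 + beta n k * (n ^ 2 - 2) := by
  have hk₀ : (0 : ℝ) < k := by exact_mod_cast (by omega : 0 < k)
  have hn₁ : (0 : ℝ) ≤ n - 1 := sub_nonneg.2 (by exact_mod_cast (by omega : 1 ≤ n))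
  have hβ₀ := beta_nonneg hk hkn.le
  have hwk : (1 + beta n k * (n - 1)) / k * k = 1 + beta n k * (n - 1) :=
    div_mul_cancel₀ _ hk₀.ne'
  refine ⟨(1 + beta n k * (n - 1)) / k, by positivity, ?_, hwk, ?_⟩
  · rw [div_le_div_iff₀ hk₀ two_pos]
    linarith [two_mul_one_add_beta_le hk hkn]
  · linear_combination k * hwk - beta_mul_denom hk hkn

end Beta

section LargeValues

variable {n : ℕ}

theorem objective_eq_genObjective (A B : Matrix (Fin n) (Fin n) ℝ) :
    objective A B = genObjective fun i j u v => A i j * B u v := by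
  funext σ
  simp only [objective, matInner, permMat, genObjective, Matrix.of_apply]
  rw [← Equiv.sum_comp σ]
  refine sum_congr rfl fun i _ => ?_
  rw [← Equiv.sum_comp σ]
  simp [mul_comm]

theorem average_eq_avgOn (f : Perm (Fin n) → ℝ) : average f = avgOn univ f := by
  rw [average, avgOn_apply, Fintype.expect_eq_sum_div_card, Fintype.card_perm, Fintype.card_fin,
    one_div_mul_eq_div]

theorem shifted_eq_sub (f : Perm (Fin n) → ℝ) : shifted f = f - average f • 1 := by
  funext σ
  simp [shifted]

theorem avgOn_univ_shifted (f : Perm (Fin n) → ℝ) : avgOn univ (shifted f) = 0 := by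
  have hone : avgOn univ (1 : Perm (Fin n) → ℝ) = 1 :=
    avgOn_eq_of_forall univ_nonempty fun _ _ => rfl
  rw [shifted_eq_sub, map_sub, map_smul, hone, ← average_eq_avgOn, smul_eq_mul, mul_one, sub_self]

theorem KillsFixCounts.map_shifted_genObjective {L : (Perm (Fin n) → ℝ) →ₗ[ℝ] ℝ}
    (hL : KillsFixCounts L) (C : Fin n → Fin n → Fin n → Fin n → ℝ) :
    L (shifted (genObjective C)) = 0 := by
  rw [shifted_eq_sub, map_sub, map_smul, hL.map_genObjective, hL.map_one, smul_zero, sub_zero]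

theorem shifted_genObjective_mulLeft (C : Fin n → Fin n → Fin n → Fin n → ℝ)
    (τ : Perm (Fin n)) : shifted (genObjective fun i j u v => C i j (τ u) (τ v)) =
      fun σ => shifted (genObjective C) (τ * σ) := by
  have havg : average (genObjective fun i j u v => C i j (τ u) (τ v)) =
      average (genObjective C) := by
    rw [average_eq_avgOn, average_eq_avgOn]
    exact Fintype.expect_equiv (Equiv.mulLeft τ) _ _ fun _ => rfl
  funext σ
  rw [shifted, havg]
  rfl

theorem exists_card_le_and_beta_mul_le_avgOn_of_one {k : ℕ} (hk : 2 ≤ k) (hkn : k + 3 ≤ n)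
    (C : Fin n → Fin n → Fin n → Fin n → ℝ) :
    ∃ X : Finset (Perm (Fin n)), n ! ≤ 5 * k ! * #X ∧
      beta n k * shifted (genObjective C) 1 ≤ avgOn X (shifted (genObjective C)) := by
  have : Nontrivial (Fin n) := Fin.nontrivial_iff_two_le.2 (by omega)
  have hn : Fintype.card (Fin n) = n := Fintype.card_fin n
  have hcard_k := factorial_le_mul_card_fixCountClass_self (α := Fin n) (k := k) (by omega)
  have hcard₀ := factorial_le_mul_card_fixCountClass_self (α := Fin n) (k := 0) (by omega)
  have hcard₂ := factorial_le_mul_card_fixCountClass_zero_two (α := Fin n) (by omega)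
  rw [hn] at hcard_k hcard₀ hcard₂
  have hne {c : ℕ} {X : Finset (Perm (Fin n))} (h : n ! ≤ c * #X) : X.Nonempty :=
    card_pos.1 (Nat.pos_of_mul_pos_left (n.factorial_pos.trans_le h))
  obtain ⟨w, hw₀, hw₁, hwk, hwk'⟩ := exists_weight_beta hk (by omega : k < n)
  have hdefect := (killsFixCounts_classDefect (hne hcard_k) (hne hcard₀) (hne hcard₂)
    (by rwa [hn]) (by rwa [hn])).map_shifted_genObjective C
  rw [classDefect_apply, avgOn_univ_shifted] at hdefect
  by_contra! hsmall
  have h_k := mul_lt_mul_of_pos_left (hsmall _ hcard_k) hw₀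
  have h₀ := mul_le_mul_of_nonneg_left (hsmall _ (hcard₀.trans (by gcongr; omega))).le
    (sub_nonneg.2 hw₁)
  have h₂ := mul_le_mul_of_nonneg_left (hsmall _ (hcard₂.trans (by gcongr))).le
    (div_nonneg (sub_nonneg.2 (beta_le_one hk (by omega : k ≤ n))) zero_le_two)
  linarith

theorem exists_card_le_and_beta_mul_le_avgOn {k : ℕ} (hk : 2 ≤ k) (hkn : k + 3 ≤ n)
    (C : Fin n → Fin n → Fin n → Fin n → ℝ) (τ : Perm (Fin n)) :
    ∃ X : Finset (Perm (Fin n)), n ! ≤ 5 * k ! * #X ∧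
      beta n k * shifted (genObjective C) τ ≤ avgOn X (shifted (genObjective C)) := by
  obtain ⟨X, hX, havg⟩ := exists_card_le_and_beta_mul_le_avgOn_of_one hk hkn
    fun i j u v => C i j (τ u) (τ v)
  simp only [shifted_genObjective_mulLeft, mul_one] at havg
  refine ⟨X.map (Equiv.mulLeft τ).toEmbedding, by rwa [card_map], havg.trans_eq ?_⟩
  exact expect_equiv (Equiv.mulLeft τ) (fun σ => by simp) fun _ _ => rfl

theorem prob_setOf (p : Perm (Fin n) → Prop) [DecidablePred p] :
    prob {σ | p σ} = #{σ | p σ} / n ! := by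
  rw [prob, PMF.toOuterMeasure_uniformOfFintype_apply, Fintype.card_perm, Fintype.card_fin,
    ENNReal.toReal_div, ENNReal.toReal_natCast, ENNReal.toReal_natCast]
  congr 2
  exact Fintype.card_subtype p

theorem mul_card_le_card_filter_of_le_avgOn {ι : Type*} {X : Finset ι} {F : ι → ℝ} {M b γ : ℝ}
    (hM : 0 ≤ M) (hF : ∀ x ∈ X, F x ≤ M) (hb₀ : 0 ≤ b) (hb₁ : b ≤ 1) (hγ : 0 ≤ γ)
    (havg : b * M ≤ avgOn X F) : (1 - γ) * b * #X ≤ #{x ∈ X | γ * b * M ≤ F x} := by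
  have hsum : b * M * #X ≤ ∑ x ∈ X, F x := by
    rw [← card_mul_avgOn, mul_comm]
    gcongr
  obtain rfl | hM := hM.eq_or_lt
  · have hzero := (sum_eq_zero_iff_of_nonpos hF).1 <|
      le_antisymm (sum_nonpos hF) (by simpa using hsum)
    have hall : {x ∈ X | γ * b * 0 ≤ F x} = X :=
      filter_true_of_mem fun x hx => by rw [mul_zero, hzero x hx]
    rw [hall]
    exact mul_le_of_le_one_left (Nat.cast_nonneg _) (by nlinarith)
  · have hbound : ∑ x ∈ X, F x ≤ ∑ x ∈ X, (γ * b * M + if γ * b * M ≤ F x then M else 0) := by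
      refine sum_le_sum fun x hx => ?_
      have h₀ : 0 ≤ γ * b * M := by positivity
      split_ifs with h
      · linarith [hF x hx]
      · linarith
    rw [sum_add_distrib, sum_const, nsmul_eq_mul, ← sum_filter, sum_const, nsmul_eq_mul] at hbound
    refine le_of_mul_le_mul_right ?_ hM
    linarith

theorem shifted_nonneg_of_forall_le {f : Perm (Fin n) → ℝ} {τ : Perm (Fin n)}
    (hτ : ∀ σ, shifted f σ ≤ shifted f τ) : 0 ≤ shifted f τ := by
  rw [← avgOn_univ_shifted f]
  exact expect_le univ_nonempty fun σ _ => hτ σ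

end LargeValues

end QAP

theorem theorem5p1_general {n k : ℕ} (hk : 2 ≤ k) (hkn : k + 3 ≤ n)
    (C : Fin n → Fin n → Fin n → Fin n → ℝ) {τ : Equiv.Perm (Fin n)}
    (hτ : ∀ σ, QAP.shifted (QAP.genObjective C) σ ≤ QAP.shifted (QAP.genObjective C) τ)
    {γ : ℝ} (hγ₀ : 0 ≤ γ) (hγ₁ : γ ≤ 1) :
    (1 - γ) * QAP.beta n k / (5 * (k.factorial : ℝ)) ≤
      QAP.prob {σ | γ * QAP.beta n k * QAP.shifted (QAP.genObjective C) τ ≤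
        QAP.shifted (QAP.genObjective C) σ} := by
  classical
  obtain ⟨X, hX, havg⟩ := QAP.exists_card_le_and_beta_mul_le_avgOn hk hkn C τ
  have hβ₀ := QAP.beta_nonneg hk (by omega : k ≤ n)
  have hcount := QAP.mul_card_le_card_filter_of_le_avgOn (QAP.shifted_nonneg_of_forall_le hτ)
    (fun σ _ => hτ σ) hβ₀ (QAP.beta_le_one hk (by omega)) hγ₀ havg
  have hX' : (n.factorial : ℝ) ≤ 5 * k.factorial * X.card := by exact_mod_cast hX
  rw [QAP.prob_setOf, div_le_div_iff₀ (by positivity) (by positivity)]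
  calc (1 - γ) * QAP.beta n k * n.factorial
      ≤ (1 - γ) * QAP.beta n k * (5 * k.factorial * X.card) :=
        mul_le_mul_of_nonneg_left hX' (mul_nonneg (sub_nonneg.2 hγ₁) hβ₀)
    _ = (1 - γ) * QAP.beta n k * X.card * (5 * k.factorial) := by ring
    _ ≤ _ := by
        gcongr
        exact hcount.trans (by gcongr; exact X.subset_univ)

theorem theorem5p1 (n : ℕ) (f : Equiv.Perm (Fin n) → ℝ)
    (hf : (∃ A B : Matrix (Fin n) (Fin n) ℝ, f = QAP.objective A B) ∨
      (∃ C : Fin n → Fin n → Fin n → Fin n → ℝ, f = QAP.genObjective C))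
    (τ : Equiv.Perm (Fin n)) (hτ : ∀ σ, QAP.shifted f σ ≤ QAP.shifted f τ)
    (k : ℕ) (hk : 3 ≤ k) (hkn : k + 5 ≤ n)
    (γ : ℝ) (hγ0 : 0 < γ) (hγ1 : γ < 1) :
    (1 - γ) * QAP.beta n k / (5 * (k.factorial : ℝ)) ≤
      QAP.prob {σ | γ * QAP.beta n k * QAP.shifted f τ ≤ QAP.shifted f σ} := by
  obtain ⟨C, rfl⟩ : ∃ C, f = QAP.genObjective C :=
    hf.elim (fun ⟨A, B, h⟩ => ⟨_, h.trans (QAP.objective_eq_genObjective A B)⟩) id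
  exact theorem5p1_general (by omega) (by omega) C hτ hγ0.le hγ1.le
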